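/- Let $\mathbf{Mnd}$ be the category of monads on $\mathbf{Sets}$ and monad maps. Every monad $T$ on $\mathbf{Sets}$ has the canonical strength $\mathsf{st}\colon T(X)\times Y\to T(X\times Y)$, $\mathsf{st}(u,y)=T(\lambda x.\langle x,y\rangle)(u)$, and the swapped strength $\mathsf{st}'\colon X\times T(Y)\to T(X\times Y)$, $\mathsf{st}'=T(\gamma)\circ\mathsf{st}\circ\gamma$, with $\gamma$ the swap map. $T$ is commutative if $\mu\circ T(\mathsf{st}')\circ\mathsf{st}=\mu\circ T(\mathsf{st})\circ\mathsf{st}'\colon T(X)\times T(Y)\to T(X\times Y)$ for all $X,Y$; this common map is then called $\mathsf{dst}$. Let $\mathbf{CMnd}\subseteq\mathbf{Mnd}$ be the full subcategory of commutative monads. Let $\aleph_0$ be the category with objects $n\in\mathbb{N}$ and with the functions $\underline n\to\underline m$ as morphisms $n\to m$, where $\underline n=\{0,\dots,n-1\}$. A Lawvere theory is a small category $\mathbf{L}$ with objects the natural numbers, together with a functor $\aleph_0\to\mathbf{L}$ that is the identity on objects and preserves finite coproducts $(+,0)$ on the nose; morphisms of Lawvere theories are functors that are the identity on objects and strictly preserve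 finite coproducts. This gives the category $\mathbf{Law}$. The category $\aleph_0$ is symmetric monoidal: its tensor is multiplication $n\times m$ on objects, with unit $1$, and on morphisms $f\otimes g=\mathsf{co}^{-1}\circ(f\times g)\circ\mathsf{co}$, where $\mathsf{co}_{n,m}\colon\underline{n\times m}\to\underline n\times\underline m$ is the coordinatisation given by $\mathsf{co}(c)=(a,b)\iff c=a\cdot m+b$; the structure isomorphisms are those of $(\mathbf{Sets},\times,1)$, transported along $\mathsf{co}$. The objects of $\mathbf{SMLaw}$ are the Lawvere theories $\mathbf{L}$ equipped with a symmetric monoidal structure that is strictly preserved by $\aleph_0\to\mathbf{L}$; its morphisms are the morphisms of $\mathbf{Law}$ that strictly preserve the tensor. Let $\mathcal{T}\colon\mathbf{Law}\to\mathbf{Mnd}$ be the functor sending $\mathbf{L}$ to the monad $$T_{\mathbf{L}}(X)=\Big(\coprod_{i\in\mathbb{N}}\mathbf{L}(1,i)\times X^i\Big)/\!\sim,$$ where $\sim$ is the least equivalence relation with $\kappa_m(f\circ g,v)\sim\kappa_i(g,v\circ f)$ for all $f\colon i\to m$ in $\aleph_0$, $g\in\mathbf{L}(1,i)$, $v\in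 X^m$; its unit is $x\mapsto[\kappa_1(\mathrm{id}_1,x)]$, its multiplication sends $[\kappa_i(g,v)]$ with $v(a)=[\kappa_{j_a}(g_a,v_a)]$ to $[\kappa_j((g_0+\cdots+g_{i-1})\circ g,[v_0,\dots,v_{i-1}])]$, where $j=j_0+\cdots+j_{i-1}$, and a morphism $F$ is sent to $[\kappa_i(g,v)]\mapsto[\kappa_i(F(g),v)]$. Let $\mathcal{K}\ell_{\mathbb{N}}\colon\mathbf{Mnd}\to\mathbf{Law}$ be the functor sending $T$ to the category with objects $n\in\mathbb{N}$, with functions $\underline n\to T(\underline m)$ as morphisms $n\to m$ and with Kleisli composition, and sending $\sigma\colon T\to S$ to $f\mapsto\sigma\circ f$. For commutative $T$, equip $\mathcal{K}\ell_{\mathbb{N}}(T)$ with the tensor $$f\otimes g=\big(\underline{n\times m}\xrightarrow{\mathsf{co}}\underline n\times\underline m\xrightarrow{f\times g}T(\underline p)\times T(\underline q)\xrightarrow{\mathsf{dst}}T(\underline p\times\underline q)\xrightarrow{T(\mathsf{co}^{-1})}T(\underline{p\times q})\big);$$ this gives a functor $\mathcal{K}\ell_{\mathbb{N}}\colon\mathbf{CMnd}\to\mathbf{SMLaw}$.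 **Lemma.** For each $\mathbf{L}\in\mathbf{SMLaw}$ the monad $\mathcal{T}(\mathbf{L})$ is commutative, so that $\mathcal{T}\colon\mathbf{Law}\to\mathbf{Mnd}$ restricts to a functor $\mathbf{SMLaw}\to\mathbf{CMnd}$. This restriction is left adjoint to $\mathcal{K}\ell_{\mathbb{N}}\colon\mathbf{CMnd}\to\mathbf{SMLaw}$. More precisely, there is an adjunction $\mathcal{T}\dashv\mathcal{K}\ell_{\mathbb{N}}$ between $\mathbf{Law}$ and $\mathbf{Mnd}$ whose unit $\mathbf{L}\to\mathcal{K}\ell_{\mathbb{N}}(\mathcal{T}(\mathbf{L}))$ sends $f\colon n\to m$ to $i\mapsto[\kappa_m(f\circ\kappa_i,\mathrm{id}_m)]$, where $\kappa_i\colon 1\to n$ is the $i$-th coprojection, and it restricts to an adjunction between $\mathbf{SMLaw}$ and $\mathbf{CMnd}$ with the same unit. -/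

import Mathlib

open CategoryTheory

universe u

noncomputable section

namespace SMLaw

/-! ## The category of natural numbers and functions, with its tensor -/

/-- Coordinatisation of `{0, …, n * m - 1}`: `co c = (a, b)` iff `c = a * m + b`. -/
def co (n m : ℕ) : Fin (n * m) ≃ Fin n × Fin m := finProdFinEquiv.symm

theorem co_eq_iff {n m : ℕ} (c : Fin (n * m)) (a : Fin n) (b : Fin m) :
    co n m c = (a, b) ↔ (c : ℕ) = a * m + b := by
  rw [co, Equiv.symm_apply_eq, Fin.ext_iff]
  simp [finProdFinEquiv, mul_comm, add_comm]

/-- `f ⊗ g` on functions between finite ordinals. -/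
def tensorFun {n p m q : ℕ} (f : Fin n → Fin p) (g : Fin m → Fin q) :
    Fin (n * m) → Fin (p * q) :=
  fun c => (co p q).symm (f (co n m c).1, g (co n m c).2)

/-- The associativity map `n ⊗ (m ⊗ k) → (n ⊗ m) ⊗ k`. -/
def assocFun (n m k : ℕ) : Fin (n * (m * k)) → Fin (n * m * k) :=
  fun c => (co (n * m) k).symm
    ((co n m).symm ((co n (m * k) c).1, (co m k (co n (m * k) c).2).1),
      (co m k (co n (m * k) c).2).2)

/-- The inverse `(n ⊗ m) ⊗ k → n ⊗ (m ⊗ k)` of the associativity map. -/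
def assocInvFun (n m k : ℕ) : Fin (n * m * k) → Fin (n * (m * k)) :=
  fun c => (co n (m * k)).symm ((co n m (co (n * m) k c).1).1,
    (co m k).symm ((co n m (co (n * m) k c).1).2, (co (n * m) k c).2))

/-- The left unit map `1 ⊗ n → n`. -/
def leftUnitFun (n : ℕ) : Fin (1 * n) → Fin n := fun c => (co 1 n c).2

/-- The right unit map `n ⊗ 1 → n`. -/
def rightUnitFun (n : ℕ) : Fin (n * 1) → Fin n := fun c => (co n 1 c).1

/-- The swap map `n ⊗ m → m ⊗ n`. -/
def swapFun (n m : ℕ) : Fin (n * m) → Fin (m * n) :=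
  fun c => (co m n).symm ((co n m c).2, (co n m c).1)

/-! ## Lawvere theories -/

/-- A Lawvere theory: a small category whose objects are the natural numbers (`comp f g` is `f`
followed by `g`), with an identity-on-objects functor `incl` from the category of natural numbers
and functions that preserves finite coproducts on the nose: `0` is initial, and `n + m` is a
coproduct with as coprojections the images of the standard ones. -/
structure LawvereTheory : Type (u + 1) where
  /-- The morphisms `n → m`. -/
  Hom : ℕ → ℕ → Type u
  /-- Identities. -/
  id (n : ℕ) : Hom n n
  /-- Composition, in diagrammatic order. -/
  comp {n m k : ℕ} (f : Hom n m) (g : Hom m k) : Hom n k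
  id_comp {n m : ℕ} (f : Hom n m) : comp (id n) f = f
  comp_id {n m : ℕ} (f : Hom n m) : comp f (id m) = f
  assoc {n m k l : ℕ} (f : Hom n m) (g : Hom m k) (h : Hom k l) :
    comp (comp f g) h = comp f (comp g h)
  /-- The functor from the category of natural numbers and functions. -/
  incl {n m : ℕ} (f : Fin n → Fin m) : Hom n m
  incl_id (n : ℕ) : incl (_root_.id : Fin n → Fin n) = id n
  incl_comp {n m k : ℕ} (f : Fin n → Fin m) (g : Fin m → Fin k) :
    incl (g ∘ f) = comp (incl f) (incl g)
  existsUnique_zero (k : ℕ) : ∃! _h : Hom 0 k, True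
  existsUnique_add {n m k : ℕ} (f : Hom n k) (g : Hom m k) :
    ∃! h : Hom (n + m) k, comp (incl (Fin.castAdd m)) h = f ∧ comp (incl (Fin.natAdd n)) h = g

/-- A morphism of Lawvere theories: an identity-on-objects functor that strictly preserves
finite coproducts, i.e. preserves the coprojections. -/
@[ext]
structure LawvereMap (L K : LawvereTheory.{u}) : Type u where
  /-- The action on morphisms. -/
  map {n m : ℕ} (f : L.Hom n m) : K.Hom n m
  map_id (n : ℕ) : map (L.id n) = K.id n
  map_comp {n m k : ℕ} (f : L.Hom n m) (g : L.Hom m k) :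
    map (L.comp f g) = K.comp (map f) (map g)
  map_inl (n m : ℕ) : map (L.incl (Fin.castAdd m : Fin n → _)) = K.incl (Fin.castAdd m)
  map_inr (n m : ℕ) : map (L.incl (Fin.natAdd n : Fin m → _)) = K.incl (Fin.natAdd n)

/-- The category of Lawvere theories. -/
instance : Category LawvereTheory.{u} where
  Hom := LawvereMap
  id L := ⟨fun f => f, fun _ => rfl, fun _ _ => rfl, fun _ _ => rfl, fun _ _ => rfl⟩
  comp F G := ⟨fun f => G.map (F.map f), fun _ => by rw [F.map_id, G.map_id],
    fun _ _ => by rw [F.map_comp, G.map_comp], fun _ _ => by rw [F.map_inl, G.map_inl],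
    fun _ _ => by rw [F.map_inr, G.map_inr]⟩

namespace LawvereTheory

variable (L : LawvereTheory.{u})

/-- The map `κ_i : 1 → n` picking out `i`. -/
def pick {n : ℕ} (i : Fin n) : L.Hom 1 n := L.incl fun _ => i

theorem zero_ext {k : ℕ} (f g : L.Hom 0 k) : f = g :=
  (L.existsUnique_zero k).unique trivial trivial

theorem pick_incl {n m : ℕ} (i : Fin n) (f : Fin n → Fin m) :
    L.comp (L.pick i) (L.incl f) = L.pick (f i) := by
  rw [pick, ← L.incl_comp]; rfl

theorem pick_zero_one : L.pick (0 : Fin 1) = L.id 1 := by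
  rw [← L.incl_id, pick]
  congr 1
  funext i
  exact Subsingleton.elim _ _

theorem existsUnique_cotuple {k : ℕ} : ∀ {n : ℕ} (g : Fin n → L.Hom 1 k),
    ∃! h : L.Hom n k, ∀ i, L.comp (L.pick i) h = g i
  | 0, g => ⟨(L.existsUnique_zero k).exists.choose, fun i => i.elim0, fun _ _ => L.zero_ext _ _⟩
  | n + 1, g => by
    obtain ⟨h, hh, hu⟩ := existsUnique_cotuple (fun i : Fin n => g i.castSucc)
    obtain ⟨t, ⟨ht1, ht2⟩, htu⟩ := L.existsUnique_add h (g (Fin.last n))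
    have e1 (i : Fin n) : L.pick i.castSucc =
        L.comp (L.pick i) (L.incl (Fin.castAdd 1)) := (L.pick_incl _ _).symm
    have e2 : L.pick (Fin.last n) = L.incl (Fin.natAdd n) := by
      rw [pick]; congr 1; funext i
      rw [Subsingleton.elim i 0]; rfl
    refine ⟨t, fun i => ?_, fun s hs => htu s ⟨hu _ fun i => ?_, ?_⟩⟩
    · refine Fin.lastCases ?_ (fun i => ?_) i
      · rw [e2, ht2]
      · rw [e1, L.assoc, ht1, hh]
    · rw [← L.assoc, ← e1, hs]
    · rw [← e2, hs]

/-- The cotuple `[g_0, …, g_{n-1}] : n = 1 + ⋯ + 1 → k`. -/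
def cotuple {n k : ℕ} (g : Fin n → L.Hom 1 k) : L.Hom n k :=
  (L.existsUnique_cotuple g).choose

theorem pick_cotuple {n k : ℕ} (g : Fin n → L.Hom 1 k) (i : Fin n) :
    L.comp (L.pick i) (L.cotuple g) = g i :=
  (L.existsUnique_cotuple g).choose_spec.1 i

theorem hom_ext {n k : ℕ} {f g : L.Hom n k}
    (h : ∀ i, L.comp (L.pick i) f = L.comp (L.pick i) g) : f = g :=
  (L.existsUnique_cotuple fun i => L.comp (L.pick i) g).unique h fun _ => rfl

theorem cotuple_comp {n k l : ℕ} (g : Fin n → L.Hom 1 k) (h : L.Hom k l) :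
    L.comp (L.cotuple g) h = L.cotuple fun i => L.comp (g i) h :=
  L.hom_ext fun i => by rw [← L.assoc, pick_cotuple, pick_cotuple]

theorem incl_cotuple {n m k : ℕ} (f : Fin n → Fin m) (g : Fin m → L.Hom 1 k) :
    L.comp (L.incl f) (L.cotuple g) = L.cotuple fun i => g (f i) :=
  L.hom_ext fun i => by rw [← L.assoc, pick_incl, pick_cotuple, pick_cotuple]

theorem cotuple_pick {n m : ℕ} (f : Fin n → Fin m) :
    (L.cotuple fun i => L.pick (f i)) = L.incl f :=
  L.hom_ext fun i => by rw [pick_incl, pick_cotuple]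

end LawvereTheory

namespace LawvereMap

variable {L K : LawvereTheory.{u}} (F : LawvereMap L K)

theorem map_pick : ∀ {n : ℕ} (i : Fin n), F.map (L.pick i) = K.pick i
  | 0, i => i.elim0
  | n + 1, i => by
    refine Fin.lastCases ?_ (fun j => ?_) i
    · have e : (fun _ => Fin.last n : Fin 1 → Fin (n + 1)) = Fin.natAdd n := by
        funext i; rw [Subsingleton.elim i 0]; rfl
      rw [LawvereTheory.pick, LawvereTheory.pick, e, F.map_inr]
    · have h1 := L.pick_incl j (Fin.castAdd 1)
      have h2 := K.pick_incl j (Fin.castAdd 1)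
      change _ = L.pick j.castSucc at h1
      change _ = K.pick j.castSucc at h2
      rw [← h1, ← h2, F.map_comp, F.map_inl, map_pick]

/-- A morphism of Lawvere theories commutes with the functors from the category of natural
numbers and functions. -/
theorem map_incl {n m : ℕ} (f : Fin n → Fin m) : F.map (L.incl f) = K.incl f :=
  K.hom_ext fun i => by
    rw [← F.map_pick, ← F.map_comp, L.pick_incl, F.map_pick, F.map_pick, K.pick_incl]

theorem map_cotuple {n k : ℕ} (g : Fin n → L.Hom 1 k) :
    F.map (L.cotuple g) = K.cotuple fun i => F.map (g i) :=
  K.hom_ext fun i => by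
    rw [← F.map_pick, ← F.map_comp, L.pick_cotuple, F.map_pick, K.pick_cotuple]

end LawvereMap

/-! ## Symmetric monoidal Lawvere theories -/

/-- A symmetric monoidal Lawvere theory: a Lawvere theory with a symmetric monoidal structure
that is strictly preserved by `incl`.  So the tensor is multiplication on objects, the tensor unit
is `1`, and the structure isomorphisms are the images under `incl` of those of the category of
natural numbers and functions.  (The coherence equations then hold automatically, see
`SMLaw.SMLawvereTheory.symmetricCategory`.) -/
structure SMLawvereTheory : Type (u + 1) extends LawvereTheory.{u} where
  /-- The tensor of morphisms. -/
  tensor {n p m q : ℕ} (f : Hom n p) (g : Hom m q) : Hom (n * m) (p * q)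
  tensor_id (n m : ℕ) : tensor (id n) (id m) = id (n * m)
  tensor_comp {n p r m q s : ℕ} (f : Hom n p) (f' : Hom p r) (g : Hom m q) (g' : Hom q s) :
    tensor (comp f f') (comp g g') = comp (tensor f g) (tensor f' g')
  incl_tensor {n p m q : ℕ} (f : Fin n → Fin p) (g : Fin m → Fin q) :
    incl (tensorFun f g) = tensor (incl f) (incl g)
  assoc_natural {n p m q k r : ℕ} (f : Hom n p) (g : Hom m q) (h : Hom k r) :
    comp (tensor f (tensor g h)) (incl (assocFun p q r)) =
      comp (incl (assocFun n m k)) (tensor (tensor f g) h)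
  leftUnit_natural {n m : ℕ} (f : Hom n m) :
    comp (tensor (id 1) f) (incl (leftUnitFun m)) = comp (incl (leftUnitFun n)) f
  rightUnit_natural {n m : ℕ} (f : Hom n m) :
    comp (tensor f (id 1)) (incl (rightUnitFun m)) = comp (incl (rightUnitFun n)) f
  swap_natural {n p m q : ℕ} (f : Hom n p) (g : Hom m q) :
    comp (tensor f g) (incl (swapFun p q)) = comp (incl (swapFun n m)) (tensor g f)

/-- A morphism of symmetric monoidal Lawvere theories: a morphism of Lawvere theories that
strictly preserves the tensor. -/
@[ext]
structure SMLawvereMap (L K : SMLawvereTheory.{u}) : Type u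
    extends LawvereMap L.toLawvereTheory K.toLawvereTheory where
  map_tensor {n p m q : ℕ} (f : L.Hom n p) (g : L.Hom m q) :
    map (L.tensor f g) = K.tensor (map f) (map g)

/-- The category of symmetric monoidal Lawvere theories. -/
instance : Category SMLawvereTheory.{u} where
  Hom := SMLawvereMap
  id L := ⟨𝟙 L.toLawvereTheory, fun _ _ => rfl⟩
  comp {L K M} F G :=
    ⟨(show L.toLawvereTheory ⟶ K.toLawvereTheory from F.toLawvereMap) ≫
        (show K.toLawvereTheory ⟶ M.toLawvereTheory from G.toLawvereMap),
      fun f g => by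
        change G.map (F.map _) = _
        rw [F.map_tensor, G.map_tensor]
        rfl⟩

/-- The functor that forgets the tensor. -/
def forgetSM : SMLawvereTheory.{u} ⥤ LawvereTheory.{u} where
  obj L := L.toLawvereTheory
  map F := F.toLawvereMap

/-! ### Comparison with the library notion of symmetric monoidal category -/

/-- The objects of a symmetric monoidal Lawvere theory. -/
@[ext]
structure SMLawvereTheory.Obj (_L : SMLawvereTheory.{u}) : Type where
  /-- The natural number. -/
  val : ℕ

namespace SMLawvereTheory

variable (L : SMLawvereTheory.{u})

instance category : Category L.Obj where
  Hom n m := L.Hom n.val m.val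
  id n := L.id n.val
  comp f g := L.comp f g
  id_comp f := L.id_comp f
  comp_id f := L.comp_id f
  assoc f g h := L.assoc f g h

/-- The image in `L` of a bijection of finite ordinals. -/
def inclIso {n m : L.Obj} (f : Fin n.val → Fin m.val) (g : Fin m.val → Fin n.val)
    (h1 : ∀ c, g (f c) = c) (h2 : ∀ c, f (g c) = c) : n ≅ m where
  hom := L.incl f
  inv := L.incl g
  hom_inv_id := (L.incl_comp f g).symm.trans
    ((congrArg L.incl (funext h1)).trans (L.incl_id _))
  inv_hom_id := (L.incl_comp g f).symm.trans
    ((congrArg L.incl (funext h2)).trans (L.incl_id _))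

theorem square_inv {C : Type*} [Category C] {X Y X' Y' : C} (a : X ≅ X') (b : Y ≅ Y')
    {s : X ⟶ Y} {t : X' ⟶ Y'} (h : s ≫ b.hom = a.hom ≫ t) : t ≫ b.inv = a.inv ≫ s := by
  rw [Iso.comp_inv_eq, Category.assoc, h, Iso.inv_hom_id_assoc]

instance monoidalCategory : MonoidalCategory L.Obj where
  tensorObj n m := ⟨n.val * m.val⟩
  tensorUnit := ⟨1⟩
  tensorHom f g := L.tensor f g
  whiskerLeft n _ _ f := L.tensor (L.id n.val) f
  whiskerRight f n := L.tensor f (L.id n.val)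
  associator n m k := (L.inclIso (n := ⟨n.val * (m.val * k.val)⟩) (m := ⟨n.val * m.val * k.val⟩)
    (assocFun n.val m.val k.val) (assocInvFun n.val m.val k.val)
    (by simp [assocFun, assocInvFun]) (by simp [assocFun, assocInvFun])).symm
  leftUnitor n := L.inclIso (n := ⟨1 * n.val⟩) (leftUnitFun n.val)
    (fun b => (co 1 n.val).symm (0, b))
    (fun c => by
      rw [Equiv.symm_apply_eq]; exact Prod.ext (Subsingleton.elim _ _) rfl)
    (by simp [leftUnitFun])
  rightUnitor n := L.inclIso (n := ⟨n.val * 1⟩) (rightUnitFun n.val)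
    (fun b => (co n.val 1).symm (b, 0))
    (fun c => by
      rw [Equiv.symm_apply_eq]; exact Prod.ext rfl (Subsingleton.elim _ _))
    (by simp [rightUnitFun])
  tensorHom_def {n n' m m'} f g := by
    change L.tensor f g = L.comp (L.tensor f (L.id m.val)) (L.tensor (L.id n'.val) g)
    rw [← L.tensor_comp, L.comp_id, L.id_comp]
  id_tensorHom_id n m := L.tensor_id n.val m.val
  tensorHom_comp_tensorHom f g f' g' := (L.tensor_comp f f' g g').symm
  whiskerLeft_id n m := L.tensor_id n.val m.val
  id_whiskerRight n m := L.tensor_id n.val m.val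
  associator_naturality {n m k p q r} f g h := by
    exact square_inv _ _ (L.assoc_natural f g h)
  leftUnitor_naturality f := L.leftUnit_natural f
  rightUnitor_naturality f := L.rightUnit_natural f
  pentagon n m k l := by
    change L.comp (L.tensor (L.incl (assocInvFun n.val m.val k.val)) (L.id l.val))
      (L.comp (L.incl (assocInvFun n.val (m.val * k.val) l.val))
        (L.tensor (L.id n.val) (L.incl (assocInvFun m.val k.val l.val)))) =
      L.comp (L.incl (assocInvFun (n.val * m.val) k.val l.val))
        (L.incl (assocInvFun n.val m.val (k.val * l.val)))
    simp only [← L.incl_id, ← L.incl_tensor, ← L.incl_comp]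
    congr 1
    funext c
    simp [tensorFun, assocInvFun]
  triangle n m := by
    change L.comp (L.incl (assocInvFun n.val 1 m.val))
        (L.tensor (L.id n.val) (L.incl (leftUnitFun m.val))) =
      L.tensor (L.incl (rightUnitFun n.val)) (L.id m.val)
    simp only [← L.incl_id, ← L.incl_tensor, ← L.incl_comp]
    congr 1
    funext c
    simp [tensorFun, assocInvFun, leftUnitFun, rightUnitFun]

instance symmetricCategory : SymmetricCategory L.Obj where
  braiding n m := L.inclIso (n := ⟨n.val * m.val⟩) (m := ⟨m.val * n.val⟩)
    (swapFun n.val m.val) (swapFun m.val n.val) (by simp [swapFun]) (by simp [swapFun])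
  braiding_naturality_right n _ _ f := L.swap_natural (L.id n.val) f
  braiding_naturality_left f n := L.swap_natural f (L.id n.val)
  hexagon_forward n m k := by
    change L.comp (L.incl (assocInvFun n.val m.val k.val))
      (L.comp (L.incl (swapFun n.val (m.val * k.val)))
        (L.incl (assocInvFun m.val k.val n.val))) =
      L.comp (L.tensor (L.incl (swapFun n.val m.val)) (L.id k.val))
        (L.comp (L.incl (assocInvFun m.val n.val k.val))
          (L.tensor (L.id m.val) (L.incl (swapFun n.val k.val))))
    simp only [← L.incl_id, ← L.incl_tensor, ← L.incl_comp]
    congr 1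
    funext c
    simp [tensorFun, assocInvFun, swapFun]
  hexagon_reverse n m k := by
    change L.comp (L.incl (assocFun n.val m.val k.val))
      (L.comp (L.incl (swapFun (n.val * m.val) k.val))
        (L.incl (assocFun k.val n.val m.val))) =
      L.comp (L.tensor (L.id n.val) (L.incl (swapFun m.val k.val)))
        (L.comp (L.incl (assocFun n.val k.val m.val))
          (L.tensor (L.incl (swapFun n.val k.val)) (L.id m.val)))
    simp only [← L.incl_id, ← L.incl_tensor, ← L.incl_comp]
    congr 1
    funext c
    simp [tensorFun, assocFun, swapFun]
  symmetry n m := L.inclIso _ _ _ _ |>.hom_inv_id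

end SMLawvereTheory

/-! ## Commutative monads on sets -/

/-- The set `{0, …, n - 1}`. -/
abbrev Num (n : ℕ) : Type u := ULift.{u} (Fin n)

/-- The strength `st : T X × Y → T (X × Y)` of a monad on sets. -/
def st (T : Monad (Type u)) (X Y : Type u) : T.obj X × Y → T.obj (X × Y) :=
  fun p => T.map (↾fun x : X => (x, p.2)) p.1

/-- The swapped strength `st' : X × T Y → T (X × Y)`. -/
def st' (T : Monad (Type u)) (X Y : Type u) : X × T.obj Y → T.obj (X × Y) :=
  fun p => T.map (↾(Prod.swap : Y × X → X × Y)) (st T Y X p.swap)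

/-- The composite `μ ∘ T (st') ∘ st : T X × T Y → T (X × Y)`. -/
def dst (T : Monad (Type u)) (X Y : Type u) : T.obj X × T.obj Y → T.obj (X × Y) :=
  fun p => T.μ.app (X × Y) (T.map (↾st' T X Y) (st T X (T.obj Y) p))

/-- The composite `μ ∘ T (st) ∘ st' : T X × T Y → T (X × Y)`. -/
def dst' (T : Monad (Type u)) (X Y : Type u) : T.obj X × T.obj Y → T.obj (X × Y) :=
  fun p => T.μ.app (X × Y) (T.map (↾st T X Y) (st' T (T.obj X) Y p))

/-- A monad on sets is commutative if the two maps `T X × T Y → T (X × Y)` agree. -/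
def IsCommutative : ObjectProperty (Monad (Type u)) :=
  fun T => ∀ X Y : Type u, dst T X Y = dst' T X Y

/-- The category of commutative monads on sets and monad maps (which commute with the strengths
by naturality). -/
abbrev CommMonad : Type (u + 1) := (IsCommutative.{u}).FullSubcategory

/-! ## The monad of a Lawvere theory -/

namespace LawvereTheory

variable (L : LawvereTheory.{u})

/-- The disjoint union of the sets `L(1, i) × X ^ i`, for `i` a natural number. -/
abbrev PreTerm (X : Type u) : Type u := Σ i : ℕ, L.Hom 1 i × (Fin i → X)

/-- The generating relation `κ_m (f ∘ g, v) ∼ κ_i (g, v ∘ f)`. -/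
inductive TermRel (X : Type u) : L.PreTerm X → L.PreTerm X → Prop
  | mk {i m : ℕ} (f : Fin i → Fin m) (g : L.Hom 1 i) (v : Fin m → X) :
    TermRel X ⟨m, L.comp g (L.incl f), v⟩ ⟨i, g, v ∘ f⟩

/-- The set `T_L(X)`: the quotient of the disjoint union of the `L(1, i) × X ^ i` by the least
equivalence relation containing `TermRel`. -/
def Term (X : Type u) : Type u := Quot (L.TermRel X)

variable {L}

/-- The class `[κ_i (g, v)]`. -/
def term {X : Type u} {i : ℕ} (g : L.Hom 1 i) (v : Fin i → X) : L.Term X :=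
  Quot.mk _ ⟨i, g, v⟩

theorem term_comp_incl {X : Type u} {i m : ℕ} (f : Fin i → Fin m) (g : L.Hom 1 i)
    (v : Fin m → X) : term (L.comp g (L.incl f)) v = term g fun a => v (f a) :=
  Quot.sound (TermRel.mk f g v)

theorem term_ind {X : Type u} {P : L.Term X → Prop}
    (h : ∀ {i : ℕ} (g : L.Hom 1 i) (v : Fin i → X), P (term g v)) (t : L.Term X) : P t := by
  obtain ⟨i, g, v⟩ := t
  exact h g v

/-- The action `[κ_i (g, v)] ↦ [κ_i (g, h ∘ v)]` of `T_L` on functions. -/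
def termMap {X Y : Type u} (h : X → Y) : L.Term X → L.Term Y :=
  Quot.lift (fun t => term t.2.1 fun a => h (t.2.2 a)) (by
    rintro _ _ ⟨f, g, v⟩
    exact term_comp_incl f g fun a => h (v a))

/-- For `g : 1 → i` and `t_a = κ_{j_a} (g_a, v_a)`, the element
`[κ_j ((g_0 + ⋯ + g_{i-1}) ∘ g, [v_0, …, v_{i-1}])]`, where `j = j_0 + ⋯ + j_{i-1}`. -/
def flatten {X : Type u} {i : ℕ} (g : L.Hom 1 i) (t : Fin i → L.PreTerm X) : L.Term X :=
  term (i := ∑ a, (t a).1)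
    (L.comp g (L.cotuple fun a => L.comp (t a).2.1 (L.incl fun b => finSigmaFinEquiv ⟨a, b⟩)))
    (fun c => (t (finSigmaFinEquiv.symm c).1).2.2 (finSigmaFinEquiv.symm c).2)

theorem flatten_eq {X : Type u} {i k : ℕ} (g : L.Hom 1 i) (t : Fin i → L.PreTerm X)
    (w : Fin k → X) (e : ∀ a, Fin (t a).1 → Fin k) (he : ∀ a b, w (e a b) = (t a).2.2 b) :
    flatten g t = term (L.comp g (L.cotuple fun a => L.comp (t a).2.1 (L.incl (e a)))) w := by
  have key := term_comp_incl
    (fun c => e (finSigmaFinEquiv.symm c).1 (finSigmaFinEquiv.symm c).2)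
    (L.comp g (L.cotuple fun a => L.comp (t a).2.1 (L.incl fun b => finSigmaFinEquiv ⟨a, b⟩))) w
  rw [L.assoc, cotuple_comp] at key
  simp only [he] at key
  refine key.symm.trans ?_
  congr 3
  funext a
  rw [L.assoc, ← L.incl_comp]
  congr 2
  funext b
  have h := finSigmaFinEquiv.symm_apply_apply (⟨a, b⟩ : (a : Fin i) × Fin (t a).1)
  exact congrArg (fun x : (a : Fin i) × Fin (t a).1 => e x.1 x.2) h

theorem flatten_rel {X : Type u} {i : ℕ} (g : L.Hom 1 i) (s t : Fin i → L.PreTerm X)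
    (h : ∀ a, ∃ f : Fin (t a).1 → Fin (s a).1,
      (s a).2.1 = L.comp (t a).2.1 (L.incl f) ∧ ∀ b, (t a).2.2 b = (s a).2.2 (f b)) :
    flatten g s = flatten g t := by
  choose f hf hv using h
  rw [flatten_eq g t
    (fun c => (s (finSigmaFinEquiv.symm c).1).2.2 (finSigmaFinEquiv.symm c).2)
    (fun a b => finSigmaFinEquiv ⟨a, f a b⟩), flatten]
  · congr 3
    funext a
    rw [hf, L.assoc, ← L.incl_comp]
    rfl
  · intro a b
    have h := finSigmaFinEquiv.symm_apply_apply (⟨a, f a b⟩ : (a : Fin i) × Fin (s a).1)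
    rw [h, hv]

theorem flatten_update {X : Type u} {i : ℕ} (g : L.Hom 1 i) (t : Fin i → L.PreTerm X) (a : Fin i)
    {x y : L.PreTerm X} (h : Relation.EqvGen (L.TermRel X) x y) :
    flatten g (Function.update t a x) = flatten g (Function.update t a y) := by
  induction h with
  | refl => rfl
  | symm _ _ _ ih => exact ih.symm
  | trans _ _ _ _ _ ih1 ih2 => exact ih1.trans ih2
  | rel x y h =>
    obtain ⟨f, p, v⟩ := h
    refine flatten_rel g _ _ fun b => ?_
    by_cases hb : b = a
    · subst hb
      rw [Function.update_self, Function.update_self]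
      exact ⟨f, rfl, fun _ => rfl⟩
    · rw [Function.update_of_ne hb, Function.update_of_ne hb]
      exact ⟨_root_.id, by rw [L.incl_id, L.comp_id], fun _ => rfl⟩

theorem flatten_congr {X : Type u} {i : ℕ} (g : L.Hom 1 i) (s t : Fin i → L.PreTerm X)
    (h : ∀ a, (Quot.mk _ (s a) : L.Term X) = Quot.mk _ (t a)) : flatten g s = flatten g t := by
  classical
  have key (A : Finset (Fin i)) : flatten g (fun a => if a ∈ A then s a else t a) =
      flatten g t := by
    induction A using Finset.induction_on with
    | empty => simp
    | insert a A ha ih =>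
      rw [← ih]
      have h1 : (fun b => if b ∈ insert a A then s b else t b) =
          Function.update (fun b => if b ∈ A then s b else t b) a (s a) := by
        funext b
        by_cases hb : b = a
        · subst hb; simp
        · simp [hb]
      have h2 : (fun b => if b ∈ A then s b else t b) =
          Function.update (fun b => if b ∈ A then s b else t b) a (t a) := by
        funext b
        by_cases hb : b = a
        · subst hb; simp [ha]
        · simp [hb]
      rw [h1, flatten_update g _ a (Quot.eqvGen_exact (h a)), ← h2]
  simpa using key Finset.univ

/-- The multiplication of `T_L`: `[κ_i (g, v)]` is sent to
`[κ_j ((g_0 + ⋯ + g_{i-1}) ∘ g, [v_0, …, v_{i-1}])]` for any choice of representatives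
`v a = [κ_{j_a} (g_a, v_a)]`, where `j = j_0 + ⋯ + j_{i-1}`; see `termMul_eq_flatten`. -/
def termMul {X : Type u} : L.Term (L.Term X) → L.Term X :=
  Quot.lift (fun t => flatten t.2.1 fun a => (t.2.2 a).out) (by
    rintro _ _ ⟨f, g, v⟩
    change flatten (L.comp g (L.incl f)) (fun a => (v a).out) =
      flatten g fun a => (v (f a)).out
    rw [flatten_eq g (fun a => (v (f a)).out)
      (fun c => (v (finSigmaFinEquiv.symm c).1).out.2.2 (finSigmaFinEquiv.symm c).2)
      (fun a b => finSigmaFinEquiv (n := fun a => ((v a).out : L.PreTerm X).1) ⟨f a, b⟩),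
      flatten, L.assoc, incl_cotuple]
    intro a b
    exact congrArg (fun x : (a : Fin _) × Fin ((v a).out : L.PreTerm X).1 =>
      (v x.1).out.2.2 x.2) (finSigmaFinEquiv.symm_apply_apply ⟨f a, b⟩))

theorem termMul_eq_flatten {X : Type u} {i : ℕ} (g : L.Hom 1 i) (t : Fin i → L.PreTerm X) :
    termMul (term g fun a => (Quot.mk _ (t a) : L.Term X)) = flatten g t :=
  flatten_congr g _ t fun _ => Quot.out_eq _

theorem termMul_term {X : Type u} {i k : ℕ} (g : L.Hom 1 i) (p : Fin i → L.Hom 1 k)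
    (w : Fin k → X) : termMul (term g fun a => term (p a) w) =
      term (L.comp g (L.cotuple p)) w := by
  refine (termMul_eq_flatten g fun a => ⟨k, p a, w⟩).trans ?_
  rw [flatten_eq g _ w (fun _ b => b) fun _ _ => rfl]
  congr 3
  funext a
  exact (congrArg _ (L.incl_id _)).trans (L.comp_id _)

/-- Finitely many elements of `T_L(X)` have representatives with a common second component. -/
theorem exists_common {X : Type u} {i : ℕ} (t : Fin i → L.Term X) :
    ∃ (k : ℕ) (p : Fin i → L.Hom 1 k) (w : Fin k → X), t = fun a => term (p a) w := by
  refine ⟨∑ a, (t a).out.1,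
    fun a => L.comp (t a).out.2.1 (L.incl fun b => finSigmaFinEquiv ⟨a, b⟩),
    fun c => (t (finSigmaFinEquiv.symm c).1).out.2.2 (finSigmaFinEquiv.symm c).2, ?_⟩
  funext a
  rw [term_comp_incl]
  refine (Quot.out_eq (t a)).symm.trans ?_
  change term (t a).out.2.1 (t a).out.2.2 = _
  congr 1
  funext b
  have h := finSigmaFinEquiv.symm_apply_apply
    (⟨a, b⟩ : (a : Fin i) × Fin ((t a).out : L.PreTerm X).1)
  rw [h]

variable (L)

/-- The monad `T_L` on sets associated with a Lawvere theory `L`, with unit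
`x ↦ [κ_1 (id, x)]`. -/
def monad : Monad (Type u) where
  obj X := L.Term X
  map h := ↾termMap h
  map_id X := by
    ext t
    induction t using term_ind
    rfl
  map_comp f g := by
    ext t
    induction t using term_ind
    rfl
  η := { app := fun X => ↾fun x : X => term (L.id 1) fun _ => x
         naturality := fun _ _ _ => rfl }
  μ :=
    { app := fun X => ↾(termMul : L.Term (L.Term X) → L.Term X)
      naturality := fun X Y f => by
        ext t
        induction t using term_ind with | h g v =>
        obtain ⟨k, p, w, rfl⟩ := exists_common v
        change termMul (term g fun a => term (p a) fun b => f (w b)) =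
          termMap f (termMul (term g fun a => term (p a) w))
        rw [termMul_term, termMul_term]
        rfl }
  assoc X := by
    ext t
    induction t using term_ind with | h g v =>
    obtain ⟨k, p, w, rfl⟩ := exists_common v
    obtain ⟨l, q, x, rfl⟩ := exists_common w
    change termMul (term g fun a => termMul (term (p a) fun b => term (q b) x)) =
      termMul (termMul (term g fun a => term (p a) fun b => term (q b) x))
    simp only [termMul_term]
    rw [L.assoc, cotuple_comp]
  left_unit X := by
    ext t
    induction t using term_ind with | h g v =>
    change termMul (term (L.id 1) fun _ => term g v) = term g v
    rw [termMul_term, L.id_comp]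
    congr 1
    rw [← L.id_comp (L.cotuple _), ← L.pick_zero_one, L.pick_cotuple]
  right_unit X := by
    ext t
    induction t using term_ind with | h g v =>
    change termMul (term g fun a => term (L.id 1) fun _ => v a) = term g v
    have h (a) : (term (L.id 1) fun _ => v a) = term (L.pick a) v := by
      rw [← L.id_comp (L.pick a), pick, term_comp_incl]
    simp only [h, termMul_term]
    have h2 (n : ℕ) : (L.cotuple fun a : Fin n => L.pick a) = L.id n :=
      (L.cotuple_pick fun a => a).trans (L.incl_id n)
    rw [h2, L.comp_id]

end LawvereTheory

/-- The map `[κ_i (g, v)] ↦ [κ_i (F g, v)]` from `T_L(X)` to `T_K(X)`. -/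
def LawvereMap.termHom {L K : LawvereTheory.{u}} (F : LawvereMap L K) (X : Type u) :
    L.Term X → K.Term X :=
  Quot.lift (fun t => LawvereTheory.term (F.map t.2.1) t.2.2) (by
    rintro _ _ ⟨f, g, v⟩
    change LawvereTheory.term (F.map _) _ = LawvereTheory.term (F.map g) fun a => v (f a)
    rw [F.map_comp, F.map_incl, LawvereTheory.term_comp_incl])

/-- The functor `𝒯` from Lawvere theories to monads on sets. -/
def theoryMonad : LawvereTheory.{u} ⥤ Monad (Type u) where
  obj L := L.monad
  map {L K} F :=
    { app := fun X => ↾LawvereMap.termHom F X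
      naturality := fun X Y f => by
        ext t
        induction t using LawvereTheory.term_ind
        rfl
      app_η := fun X => by
        ext x
        change LawvereTheory.term (LawvereMap.map F (L.id 1)) _ = LawvereTheory.term (K.id 1) _
        rw [LawvereMap.map_id]
      app_μ := fun X => by
        ext t
        induction t using LawvereTheory.term_ind with | h g v =>
        obtain ⟨k, p, w, rfl⟩ := LawvereTheory.exists_common v
        change LawvereMap.termHom F X (LawvereTheory.termMul
            (LawvereTheory.term g fun a => LawvereTheory.term (p a) w)) =
          LawvereTheory.termMul (LawvereTheory.term (LawvereMap.map F g) fun a =>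
            LawvereTheory.term (LawvereMap.map F (p a)) w)
        rw [LawvereTheory.termMul_term, LawvereTheory.termMul_term]
        change LawvereTheory.term (LawvereMap.map F _) w = _
        rw [LawvereMap.map_comp, LawvereMap.map_cotuple] }
  map_id L := by
    apply MonadHom.ext'
    funext X
    ext t
    induction t using LawvereTheory.term_ind
    rfl
  map_comp F G := by
    apply MonadHom.ext'
    funext X
    ext t
    induction t using LawvereTheory.term_ind
    rfl

/-! ## The finitary Kleisli category of a monad on sets -/

section Kleisli

variable (T : Monad (Type u))

/-- Kleisli extension `μ ∘ T f`. -/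
def bind {X Y : Type u} (f : X → T.obj Y) (t : T.obj X) : T.obj Y :=
  T.μ.app Y (T.map (↾f) t)

/-- The unit of `T`, as a function. -/
def unit {X : Type u} (x : X) : T.obj X := T.η.app X x

variable {T}

theorem bind_unit {X Y : Type u} (f : X → T.obj Y) (x : X) : bind T f (unit T x) = f x := by
  have h1 := ConcreteCategory.congr_hom (T.η.naturality (↾f)) x
  have h2 := ConcreteCategory.congr_hom (T.left_unit Y) (f x)
  exact (congrArg (T.μ.app Y) h1.symm).trans h2

theorem unit_bind {X : Type u} (t : T.obj X) : bind T (fun x => unit T x) t = t :=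
  ConcreteCategory.congr_hom (T.right_unit X) t

theorem map_comp_apply {X Y Z : Type u} (f : X → Y) (g : Y → Z) (t : T.obj X) :
    T.map (↾g) (T.map (↾f) t) = T.map (↾fun x => g (f x)) t :=
  (ConcreteCategory.congr_hom (T.map_comp (↾f) (↾g)) t).symm

theorem bind_map {X Y Z : Type u} (f : X → Y) (g : Y → T.obj Z) (t : T.obj X) :
    bind T g (T.map (↾f) t) = bind T (fun x => g (f x)) t :=
  congrArg (T.μ.app Z) (map_comp_apply f g t)

theorem map_bind {X Y Z : Type u} (f : X → T.obj Y) (g : Y → Z) (t : T.obj X) :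
    T.map (↾g) (bind T f t) = bind T (fun x => T.map (↾g) (f x)) t := by
  have h := ConcreteCategory.congr_hom (T.μ.naturality (↾g)) (T.map (↾f) t)
  refine h.symm.trans (congrArg (T.μ.app Z) ?_)
  exact map_comp_apply f (T.map (↾g)) t

theorem map_eq_bind {X Y : Type u} (f : X → Y) (t : T.obj X) :
    T.map (↾f) t = bind T (fun x => unit T (f x)) t := by
  rw [← bind_map f fun y => unit T y, unit_bind]

theorem bind_bind {X Y Z : Type u} (f : X → T.obj Y) (g : Y → T.obj Z) (t : T.obj X) :
    bind T g (bind T f t) = bind T (fun x => bind T g (f x)) t := by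
  have h := ConcreteCategory.congr_hom (T.assoc Z) (T.map (↾fun x => T.map (↾g) (f x)) t)
  refine (congrArg (T.μ.app Z) (map_bind f g t)).trans (h.symm.trans ?_)
  refine congrArg (T.μ.app Z) ?_
  exact map_comp_apply _ (T.μ.app Z) t

theorem dst_eq {X Y : Type u} (s : T.obj X) (t : T.obj Y) :
    dst T X Y (s, t) = bind T (fun x => bind T (fun y => unit T (x, y)) t) s := by
  refine (bind_map (fun x : X => (x, t)) (st' T X Y) s).trans ?_
  congr 1
  funext x
  rw [← map_eq_bind]
  exact map_comp_apply (fun y : Y => (y, x)) Prod.swap t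

theorem dst'_eq {X Y : Type u} (s : T.obj X) (t : T.obj Y) :
    dst' T X Y (s, t) = bind T (fun y => bind T (fun x => unit T (x, y)) s) t := by
  refine (congrArg (bind T (st T X Y))
    (map_comp_apply (fun y : Y => (y, s)) Prod.swap t)).trans ?_
  refine (bind_map _ (st T X Y) t).trans ?_
  congr 1
  funext y
  exact map_eq_bind _ s

theorem bind_comm (hT : IsCommutative T) {X Y Z : Type u} (f : X → Y → T.obj Z) (s : T.obj X)
    (t : T.obj Y) :
    bind T (fun x => bind T (fun y => f x y) t) s =
      bind T (fun y => bind T (fun x => f x y) s) t := by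
  have h := congrArg (bind T fun p : X × Y => f p.1 p.2) (congrFun (hT X Y) (s, t))
  rw [dst_eq, dst'_eq] at h
  simpa only [bind_bind, bind_unit] using h

end Kleisli

/-- The finitary Kleisli category of a monad `T` on sets, as a Lawvere theory: the morphisms
`n → m` are the functions `{0, …, n - 1} → T {0, …, m - 1}`, composed as in the Kleisli category. -/
def kleisliTheory (T : Monad (Type u)) : LawvereTheory.{u} where
  Hom n m := Fin n → T.obj (Num m)
  id n i := T.η.app (Num n) (ULift.up i : Num n)
  comp {n m k} f g i := T.μ.app (Num k) (T.map (↾fun j : Num m => g j.down) (f i))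
  id_comp {n _} f := funext fun i => bind_unit (fun j : Num n => f j.down) (ULift.up i)
  comp_id f := funext fun i => unit_bind (f i)
  assoc {_ m k _} f g h := funext fun i =>
    bind_bind (fun j : Num m => g j.down) (fun j : Num k => h j.down) (f i)
  incl {n m} f i := T.η.app (Num m) (ULift.up (f i) : Num m)
  incl_id n := rfl
  incl_comp {n m k} f g := funext fun i =>
    (bind_unit (T := T) (fun j : Num m => unit T (ULift.up.{u} (g j.down))) (ULift.up (f i))).symm
  existsUnique_zero k := ⟨fun i => i.elim0, trivial, fun _ _ => funext fun i => i.elim0⟩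
  existsUnique_add {n m k} f g := by
    have h1 (h : Fin (n + m) → T.obj (Num k)) (i : Fin n) :=
      bind_unit (T := T) (fun j : Num (n + m) => h j.down) (ULift.up (Fin.castAdd m i))
    have h2 (h : Fin (n + m) → T.obj (Num k)) (i : Fin m) :=
      bind_unit (T := T) (fun j : Num (n + m) => h j.down) (ULift.up (Fin.natAdd n i))
    refine ⟨Fin.append f g, ⟨funext fun i => (h1 _ i).trans (Fin.append_left f g i),
      funext fun i => (h2 _ i).trans (Fin.append_right f g i)⟩, fun h ⟨hf, hg⟩ => ?_⟩
    funext i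
    refine Fin.addCases (fun i => ?_) (fun i => ?_) i
    · rw [Fin.append_left, ← hf]
      exact (h1 h i).symm
    · rw [Fin.append_right, ← hg]
      exact (h2 h i).symm

theorem map_bind_apply {T S : Monad (Type u)} (σ : T ⟶ S) {X Y : Type u} (f : X → T.obj Y)
    (t : T.obj X) :
    σ.app Y (bind T f t) = bind S (fun x => σ.app Y (f x)) (σ.app X t) := by
  have h1 := ConcreteCategory.congr_hom (σ.app_μ Y) (T.map (↾f) t)
  refine h1.trans (congrArg (S.μ.app Y) ?_)
  change σ.app (S.obj Y) (T.map (σ.app Y) (T.map (↾f) t)) = _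
  have h2 := map_comp_apply f (σ.app Y) t
  have h3 := ConcreteCategory.congr_hom (σ.naturality (↾fun x => σ.app Y (f x))) t
  exact (congrArg (σ.app (S.obj Y)) h2).trans h3

/-- The functor `𝒦ℓ_ℕ` from monads on sets to Lawvere theories; a monad map `σ` is sent to
`f ↦ σ ∘ f`. -/
def kleisliN : Monad (Type u) ⥤ LawvereTheory.{u} where
  obj T := kleisliTheory T
  map σ :=
    { map := fun {_ m} f i => σ.app (Num m) (f i)
      map_id := fun n => funext fun i =>
        ConcreteCategory.congr_hom (MonadHom.app_η σ (Num n)) (ULift.up i : Num n)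
      map_comp := fun {_ m _} f g => funext fun i =>
        map_bind_apply σ (fun j : Num m => g j.down) (f i)
      map_inl := fun n m => funext fun i =>
        ConcreteCategory.congr_hom (MonadHom.app_η σ (Num (n + m)))
          (ULift.up (Fin.castAdd m i) : Num (n + m))
      map_inr := fun n m => funext fun i =>
        ConcreteCategory.congr_hom (MonadHom.app_η σ (Num (n + m)))
          (ULift.up (Fin.natAdd n i) : Num (n + m)) }
  map_id _ := rfl
  map_comp _ _ := rfl

/-- The tensor of `f : n → p` and `g : m → q` in the finitary Kleisli category: the composite
`T (co⁻¹) ∘ dst ∘ (f × g) ∘ co : n × m → T (p × q)`. -/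
def kleisliTensor (T : Monad (Type u)) {n p m q : ℕ} (f : Fin n → T.obj (Num p))
    (g : Fin m → T.obj (Num q)) : Fin (n * m) → T.obj (Num (p * q)) :=
  fun c => T.map (↾fun r : Num p × Num q => (ULift.up ((co p q).symm (r.1.down, r.2.down)) : Num _))
    (dst T (Num p) (Num q) (f (co n m c).1, g (co n m c).2))

theorem kleisliTensor_apply (T : Monad (Type u)) {n p m q : ℕ} (f : Fin n → T.obj (Num p))
    (g : Fin m → T.obj (Num q)) (c : Fin (n * m)) :
    kleisliTensor T f g c = bind T (fun x => bind T
      (fun y => unit T (ULift.up ((co p q).symm (x.down, y.down)))) (g (co n m c).2))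
        (f (co n m c).1) := by
  rw [kleisliTensor, dst_eq, map_eq_bind, bind_bind]
  simp only [bind_bind, bind_unit]

theorem kleisliTensor_comp {T : Monad (Type u)} (hT : IsCommutative T) {n p r m q s : ℕ}
    (f : Fin n → T.obj (Num p)) (f' : Fin p → T.obj (Num r)) (g : Fin m → T.obj (Num q))
    (g' : Fin q → T.obj (Num s)) (c : Fin (n * m)) :
    kleisliTensor T (fun i => bind T (fun j : Num p => f' j.down) (f i))
        (fun i => bind T (fun j : Num q => g' j.down) (g i)) c =
      bind T (fun d : Num (p * q) => kleisliTensor T f' g' d.down) (kleisliTensor T f g c) := by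
  simp only [kleisliTensor_apply, bind_bind, bind_unit, Equiv.apply_symm_apply]
  congr 1
  funext x
  exact bind_comm hT _ _ _

theorem kleisliTensor_unit {T : Monad (Type u)} {n p m q : ℕ} (f : Fin n → Fin p)
    (g : Fin m → Fin q) (c : Fin (n * m)) :
    kleisliTensor T (fun i => unit T (ULift.up (f i) : Num p))
      (fun i => unit T (ULift.up (g i) : Num q)) c = unit T (ULift.up (tensorFun f g c)) := by
  simp only [kleisliTensor_apply, bind_unit, tensorFun]

theorem kleisliTensor_assoc {T : Monad (Type u)} {n p m q k r : ℕ}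
    (f : Fin n → T.obj (Num p)) (g : Fin m → T.obj (Num q)) (h : Fin k → T.obj (Num r))
    (c : Fin (n * (m * k))) :
    bind T (fun d : Num (p * (q * r)) => unit T (ULift.up (assocFun p q r d.down) : Num _))
        (kleisliTensor T f (kleisliTensor T g h) c) =
      kleisliTensor T (kleisliTensor T f g) h (assocFun n m k c) := by
  simp only [kleisliTensor_apply, bind_bind, bind_unit, Equiv.apply_symm_apply, assocFun]

theorem kleisliTensor_leftUnit {T : Monad (Type u)} {n m : ℕ} (f : Fin n → T.obj (Num m))
    (c : Fin (1 * n)) :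
    bind T (fun d : Num (1 * m) => unit T (ULift.up (leftUnitFun m d.down) : Num _))
        (kleisliTensor T (fun i : Fin 1 => unit T (ULift.up i : Num 1)) f c) =
      f (leftUnitFun n c) := by
  simp only [kleisliTensor_apply, bind_bind, bind_unit, Equiv.apply_symm_apply, leftUnitFun]
  exact unit_bind _

theorem kleisliTensor_rightUnit {T : Monad (Type u)} {n m : ℕ} (f : Fin n → T.obj (Num m))
    (c : Fin (n * 1)) :
    bind T (fun d : Num (m * 1) => unit T (ULift.up (rightUnitFun m d.down) : Num _))
        (kleisliTensor T f (fun i : Fin 1 => unit T (ULift.up i : Num 1)) c) =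
      f (rightUnitFun n c) := by
  simp only [kleisliTensor_apply, bind_bind, bind_unit, Equiv.apply_symm_apply, rightUnitFun]
  exact unit_bind _

theorem kleisliTensor_swap {T : Monad (Type u)} (hT : IsCommutative T) {n p m q : ℕ}
    (f : Fin n → T.obj (Num p)) (g : Fin m → T.obj (Num q)) (c : Fin (n * m)) :
    bind T (fun d : Num (p * q) => unit T (ULift.up (swapFun p q d.down) : Num _))
        (kleisliTensor T f g c) = kleisliTensor T g f (swapFun n m c) := by
  simp only [kleisliTensor_apply, bind_bind, bind_unit, Equiv.apply_symm_apply, swapFun]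
  exact bind_comm hT _ _ _

theorem kleisliTensor_map {T S : Monad (Type u)} (σ : T ⟶ S) {n p m q : ℕ}
    (f : Fin n → T.obj (Num p)) (g : Fin m → T.obj (Num q)) (c : Fin (n * m)) :
    σ.app (Num (p * q)) (kleisliTensor T f g c) =
      kleisliTensor S (fun i => σ.app (Num p) (f i)) (fun i => σ.app (Num q) (g i)) c := by
  have h {X : Type u} (x : X) : σ.app X (unit T x) = unit S x :=
    ConcreteCategory.congr_hom (MonadHom.app_η σ X) x
  simp only [kleisliTensor_apply, map_bind_apply, h]

/-- The finitary Kleisli category of a commutative monad on sets, as a symmetric monoidal Lawvere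
theory. -/
def kleisliSMTheory (T : Monad (Type u)) (hT : IsCommutative T) : SMLawvereTheory.{u} where
  toLawvereTheory := kleisliN.obj T
  tensor f g := kleisliTensor T f g
  tensor_id n m := funext fun c =>
    (kleisliTensor_unit (T := T) (fun i : Fin n => i) (fun i : Fin m => i) c).trans
      (congrArg (fun d => unit T (ULift.up d : Num (n * m))) ((co n m).symm_apply_apply c))
  tensor_comp f f' g g' := funext (kleisliTensor_comp hT f f' g g')
  incl_tensor f g := funext fun c => (kleisliTensor_unit f g c).symm
  assoc_natural {n _ m _ k _} f g h := funext fun c => (kleisliTensor_assoc f g h c).trans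
    (bind_unit (T := T) (fun d : Num (n * m * k) => kleisliTensor T (kleisliTensor T f g) h d.down)
      (ULift.up (assocFun n m k c))).symm
  leftUnit_natural {n _} f := funext fun c => (kleisliTensor_leftUnit f c).trans
    (bind_unit (T := T) (fun d : Num n => f d.down) (ULift.up (leftUnitFun n c))).symm
  rightUnit_natural {n _} f := funext fun c => (kleisliTensor_rightUnit f c).trans
    (bind_unit (T := T) (fun d : Num n => f d.down) (ULift.up (rightUnitFun n c))).symm
  swap_natural {n _ m _} f g := funext fun c => (kleisliTensor_swap hT f g c).trans
    (bind_unit (T := T) (fun d : Num (m * n) => kleisliTensor T g f d.down)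
      (ULift.up (swapFun n m c))).symm

/-- The functor `𝒦ℓ_ℕ` from commutative monads on sets to symmetric monoidal Lawvere theories. -/
def kleisliSM : CommMonad.{u} ⥤ SMLawvereTheory.{u} where
  obj T := kleisliSMTheory T.obj T.property
  map σ :=
    { toLawvereMap := kleisliN.map σ.hom
      map_tensor := fun f g => funext (kleisliTensor_map σ.hom f g) }
  map_id _ := rfl
  map_comp _ _ := rfl

/-- On commutative monads, `𝒦ℓ_ℕ` restricts the functor `𝒦ℓ_ℕ` on all monads. -/
theorem kleisliSM_comp_forgetSM :
    kleisliSM.{u} ⋙ forgetSM.{u} = (IsCommutative.{u}).ι ⋙ kleisliN.{u} := rfl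

end SMLaw

end

noncomputable section

namespace SMLaw

/-! ### Substitution in `T_L` computed on representatives. -/

namespace LawvereTheory

variable {L : LawvereTheory.{u}}

/-! An element `[κ_i (g, v)]` of `T_L(X)` is an `i`-ary operation `g` of `L` applied to the
variables `v`. The unit of the adjunction regards the components of a morphism as operations on
generic variables. The counit evaluates: an operation of `𝒦ℓ_ℕ(T)` is an element of `T(i)`, and
`T(v)` carries it to `T(X)`. This makes sense for every monad, finitary or not. The triangle
identities come down to the unit laws of `T` and to relabelling generic variables by `v`.

For commutativity, take `s = [κ_i (g, v)]` and `t = [κ_j (h, w)]`. Both composites `T X × T Y → T (X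
× Y)` send `(s, t)` to a term on the `i × j` grid of pairs of variables. One composite applies `g`
and then a copy of `h` along each row; the other applies `h` and then a copy of `g` along each
column. Up to unitors, the copies of `h` form `id ⊗ h` and the copies of `g` form `g ⊗ id`
(`cotuple_right`, `cotuple_left`). The interchange law then identifies both operations with `g ⊗ h`,
precomposed with `1 ≅ 1 * 1` (`comp_cotuple_right`, `comp_cotuple_left`).

So the double strength of `T_L` is computed by the tensor of `L`, and the same calculation shows
that the unit preserves tensors (`kleisliUnit_tensor`). The counit needs no check because
commutative monads form a full subcategory. Equality of morphisms of symmetric monoidal theories is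
equality of the underlying maps, so naturality and the triangle identities are inherited. -/

/-- The unit of `T_L` at a value of `v`, represented with second component `v`. -/
theorem unit_apply {X : Type u} {i : ℕ} (v : Fin i → X) (a : Fin i) :
    unit L.monad (v a) = (term (L.pick a) v : L.Term X) := by
  change (term (L.id 1) fun _ => v a) = term (L.pick a) v
  rw [← L.id_comp (L.pick a), pick, term_comp_incl]

/-- Once the values `F (v a)` share one tuple of variables `w`, substitution is plain composition in
`L`, with no sum of arities to flatten. -/
theorem bind_term {X Y : Type u} {i k : ℕ} (F : X → L.Term Y) (g : L.Hom 1 i) (v : Fin i → X)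
    (p : Fin i → L.Hom 1 k) (w : Fin k → Y) (hp : ∀ a, F (v a) = term (p a) w) :
    bind L.monad F (term g v : L.Term X) = (term (L.comp g (L.cotuple p)) w : L.Term Y) := by
  rw [← termMul_term, ← funext hp]
  rfl

/-- Substituting variables for variables: the cotuple of coprojections is `incl f`. The tuple `w` is
prescribed and may be longer than `F ∘ v`, so that terms for different rows can be written over one
grid. -/
theorem bind_unit_term {X Y : Type u} {i k : ℕ} (F : X → Y) (g : L.Hom 1 i) (v : Fin i → X)
    (f : Fin i → Fin k) (w : Fin k → Y) (hf : ∀ a, F (v a) = w (f a)) :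
    bind L.monad (fun x => unit L.monad (F x)) (term g v : L.Term X) =
      (term (L.comp g (L.incl f)) w : L.Term Y) := by
  rw [← L.cotuple_pick]
  exact bind_term _ g v _ w fun a => by rw [hf]; exact unit_apply w (f a)

/-- A morphism is the cotuple of its components. This makes the unit of the adjunction respect
composition. -/
theorem term_pick_comp {X : Type u} {n m : ℕ} (f : L.Hom n m) (v : Fin m → X) (g : L.Hom 1 n) :
    termMul (term g fun i => term (L.comp (L.pick i) f) v) = term (L.comp g f) v := by
  rw [termMul_term]
  congr 2
  exact L.hom_ext fun i => L.pick_cotuple _ i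

end LawvereTheory

/-! ### The tensor of `L` computes the double strength of `T_L`. -/

namespace SMLawvereTheory

variable (L : SMLawvereTheory.{u})

/-- Naturality of the inverse right unitor, obtained by conjugating `rightUnit_natural` with the
isomorphism. It turns an operation into a whiskered one that can enter the interchange law. -/
theorem incl_rightUnit_inv {n m : ℕ} (f : L.Hom n m) :
    L.comp f (L.incl fun b => (co m 1).symm (b, 0)) =
      L.comp (L.incl fun b => (co n 1).symm (b, 0)) (L.tensor f (L.id 1)) := by
  have h (k : ℕ) : L.comp (L.incl (rightUnitFun k)) (L.incl fun b => (co k 1).symm (b, 0)) =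
      L.id (k * 1) := by
    rw [← L.incl_comp, ← L.incl_id]
    congr 1
    funext c
    exact (Equiv.symm_apply_eq _).2 (Prod.ext rfl (Subsingleton.elim _ _))
  have h' (k : ℕ) : L.comp (L.incl fun b => (co k 1).symm (b, 0)) (L.incl (rightUnitFun k)) =
      L.id k := by
    rw [← L.incl_comp, ← L.incl_id]
    congr 1
    funext c
    simp [rightUnitFun]
  rw [← L.comp_id (L.tensor f _), ← h, ← L.assoc (L.tensor f _), L.rightUnit_natural,
    L.assoc, ← L.assoc, ← L.assoc, h', L.id_comp]

theorem incl_leftUnit_inv {n m : ℕ} (f : L.Hom n m) :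
    L.comp f (L.incl fun b => (co 1 m).symm (0, b)) =
      L.comp (L.incl fun b => (co 1 n).symm (0, b)) (L.tensor (L.id 1) f) := by
  have h (k : ℕ) : L.comp (L.incl (leftUnitFun k)) (L.incl fun b => (co 1 k).symm (0, b)) =
      L.id (1 * k) := by
    rw [← L.incl_comp, ← L.incl_id]
    congr 1
    funext c
    exact (Equiv.symm_apply_eq _).2 (Prod.ext (Subsingleton.elim _ _) rfl)
  have h' (k : ℕ) : L.comp (L.incl fun b => (co 1 k).symm (0, b)) (L.incl (leftUnitFun k)) =
      L.id k := by
    rw [← L.incl_comp, ← L.incl_id]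
    congr 1
    funext c
    simp [leftUnitFun]
  rw [← L.comp_id (L.tensor _ f), ← h, ← L.assoc (L.tensor _ f), L.leftUnit_natural,
    L.assoc, ← L.assoc, ← L.assoc, h', L.id_comp]

/-- This factorisation and `tensor_eq_comp'` are the two halves of the interchange law; they
correspond to the two orders of evaluation in the definition of commutativity. -/
theorem tensor_eq_comp {n p m q : ℕ} (f : L.Hom n p) (g : L.Hom m q) :
    L.tensor f g = L.comp (L.tensor f (L.id m)) (L.tensor (L.id p) g) := by
  rw [← L.tensor_comp, L.comp_id, L.id_comp]

theorem tensor_eq_comp' {n p m q : ℕ} (f : L.Hom n p) (g : L.Hom m q) :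
    L.tensor f g = L.comp (L.tensor (L.id n) g) (L.tensor f (L.id q)) := by
  rw [← L.tensor_comp, L.comp_id, L.id_comp]

/-- The component of `f ⊗ g` at the pair `(a, b)`, as the tensor of the components of `f`
and `g`. -/
theorem pick_tensor {n p m q : ℕ} (f : L.Hom n p) (g : L.Hom m q) (a : Fin n) (b : Fin m) :
    L.comp (L.pick ((co n m).symm (a, b))) (L.tensor f g) =
      L.comp (L.pick ((co 1 1).symm (0, 0)))
        (L.tensor (L.comp (L.pick a) f) (L.comp (L.pick b) g)) := by
  rw [L.tensor_comp, ← L.assoc]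
  congr 1
  rw [LawvereTheory.pick, LawvereTheory.pick, LawvereTheory.pick, LawvereTheory.pick,
    ← L.incl_tensor, ← L.incl_comp]
  congr 1

/-- The left and right unitors agree at the object `1`: with `pick_co_right`, the same map `1 → 1 *
1` inverts both. Hence the row and column calculations end in the same precomposition. -/
theorem pick_co_left : L.pick ((co 1 1).symm (0, 0)) = L.incl fun b => (co 1 1).symm (0, b) := by
  rw [LawvereTheory.pick]; congr 1; funext b; rw [Subsingleton.elim b 0]

theorem pick_co_right : L.pick ((co 1 1).symm (0, 0)) = L.incl fun b => (co 1 1).symm (b, 0) := by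
  rw [LawvereTheory.pick]; congr 1; funext b; rw [Subsingleton.elim b 0]

/-- Copies of `h` along the rows of the grid amount to `id ⊗ h`. At the coprojection `a` the tensor
becomes `κ_a ⊗ h`; this factors as `id ⊗ h` followed by `κ_a ⊗ id`, and naturality of the left
unitor leaves `h` followed by the inclusion of row `a`. -/
theorem cotuple_right {i j : ℕ} (h : L.Hom 1 j) :
    (L.cotuple fun a : Fin i => L.comp h (L.incl fun b => (co i j).symm (a, b))) =
      L.comp (L.incl fun a => (co i 1).symm (a, 0)) (L.tensor (L.id i) h) := by
  refine L.hom_ext fun a => ?_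
  rw [L.pick_cotuple, ← L.assoc, L.pick_incl, L.pick_tensor, L.comp_id, L.pick_zero_one, L.id_comp,
    L.tensor_eq_comp', ← L.assoc, L.pick_co_left, ← L.incl_leftUnit_inv, L.assoc,
    ← L.incl_id, LawvereTheory.pick, ← L.incl_tensor, ← L.incl_comp]
  congr 2
  funext b
  simp [tensorFun]

theorem cotuple_left {i j : ℕ} (g : L.Hom 1 i) :
    (L.cotuple fun b : Fin j => L.comp g (L.incl fun a => (co i j).symm (a, b))) =
      L.comp (L.incl fun b => (co 1 j).symm (0, b)) (L.tensor g (L.id j)) := by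
  refine L.hom_ext fun b => ?_
  rw [L.pick_cotuple, ← L.assoc, L.pick_incl, L.pick_tensor, L.comp_id, L.pick_zero_one, L.id_comp,
    L.tensor_eq_comp, ← L.assoc, L.pick_co_right, ← L.incl_rightUnit_inv, L.assoc,
    ← L.incl_id, LawvereTheory.pick, ← L.incl_tensor, ← L.incl_comp]
  congr 2
  funext b
  simp [tensorFun]

/-- Moving `g` past the right unitor gives `g ⊗ id` followed by `id ⊗ h`, which is `g ⊗ h`. The
column version has the same right-hand side. -/
theorem comp_cotuple_right {i j : ℕ} (g : L.Hom 1 i) (h : L.Hom 1 j) :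
    L.comp g (L.cotuple fun a => L.comp h (L.incl fun b => (co i j).symm (a, b))) =
      L.comp (L.pick ((co 1 1).symm (0, 0))) (L.tensor g h) := by
  rw [cotuple_right, ← L.assoc, L.incl_rightUnit_inv, L.assoc, ← L.tensor_eq_comp, L.pick_co_right]

theorem comp_cotuple_left {i j : ℕ} (g : L.Hom 1 i) (h : L.Hom 1 j) :
    L.comp h (L.cotuple fun b => L.comp g (L.incl fun a => (co i j).symm (a, b))) =
      L.comp (L.pick ((co 1 1).symm (0, 0))) (L.tensor g h) := by
  rw [cotuple_left, ← L.assoc, L.incl_leftUnit_inv, L.assoc, ← L.tensor_eq_comp', L.pick_co_left]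

/-- The double strength of `T_L`, followed by a function, in terms of the tensor of `L`. -/
theorem bind_bind_term {X Y Z : Type u} {i j : ℕ} (F : X → Y → Z) (g : L.Hom 1 i) (v : Fin i → X)
    (h : L.Hom 1 j) (w : Fin j → Y) :
    bind L.monad (fun x => bind L.monad (fun y => unit L.monad (F x y))
        (LawvereTheory.term h w : L.Term Y)) (LawvereTheory.term g v : L.Term X) =
      (LawvereTheory.term (L.comp (L.pick ((co 1 1).symm (0, 0))) (L.tensor g h))
        (fun c => F (v (co i j c).1) (w (co i j c).2)) : L.Term Z) := by
  rw [← comp_cotuple_right]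
  exact LawvereTheory.bind_term _ g v _ _ fun a =>
    LawvereTheory.bind_unit_term _ h w _ _ fun b => by simp

/-- The opposite order of evaluation fills the grid by columns and reaches the same term as
`bind_bind_term`; with `F` the pairing this is commutativity. -/
theorem bind_bind_term' {X Y Z : Type u} {i j : ℕ} (F : X → Y → Z) (g : L.Hom 1 i) (v : Fin i → X)
    (h : L.Hom 1 j) (w : Fin j → Y) :
    bind L.monad (fun y => bind L.monad (fun x => unit L.monad (F x y))
        (LawvereTheory.term g v : L.Term X)) (LawvereTheory.term h w : L.Term Y) =
      (LawvereTheory.term (L.comp (L.pick ((co 1 1).symm (0, 0))) (L.tensor g h))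
        (fun c => F (v (co i j c).1) (w (co i j c).2)) : L.Term Z) := by
  rw [← comp_cotuple_left]
  exact LawvereTheory.bind_term _ h w _ _ fun a =>
    LawvereTheory.bind_unit_term _ g v _ _ fun b => by simp

/-- The monad of a symmetric monoidal Lawvere theory is commutative. -/
theorem isCommutative_monad : IsCommutative L.monad := by
  intro X Y
  funext ⟨s, t⟩
  rw [dst_eq, dst'_eq]
  induction s using LawvereTheory.term_ind with | h g v =>
  induction t using LawvereTheory.term_ind with | h h w =>
  exact (L.bind_bind_term Prod.mk g v h w).trans (L.bind_bind_term' Prod.mk g v h w).symm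

end SMLawvereTheory

/-! ## The adjunction -/

/-- The unit `f ↦ (i ↦ [κ_m (f ∘ κ_i, id)])` of the adjunction `𝒯 ⊣ 𝒦ℓ_ℕ`. -/
def kleisliUnit (L : LawvereTheory.{u}) : LawvereMap L (kleisliTheory L.monad) where
  map {_ m} f i := LawvereTheory.term (X := Num m) (L.comp (L.pick i) f) ULift.up
  map_id n := funext fun i => by
    rw [L.comp_id]
    exact (LawvereTheory.unit_apply (L := L) (ULift.up : Fin n → Num n) i).symm
  map_comp {_ m k} f g := funext fun i => by
    rw [← L.assoc, ← LawvereTheory.term_pick_comp]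
    rfl
  map_inl n m := funext fun i => by
    rw [L.pick_incl]
    exact (LawvereTheory.unit_apply (L := L) (ULift.up : Fin (n + m) → Num (n + m)) _).symm
  map_inr n m := funext fun i => by
    rw [L.pick_incl]
    exact (LawvereTheory.unit_apply (L := L) (ULift.up : Fin (n + m) → Num (n + m)) _).symm

/-- The evaluation `[κ_i (g, v)] ↦ T v (g 0)`. -/
def kleisliEval (T : Monad (Type u)) (X : Type u) : (kleisliTheory T).Term X → T.obj X :=
  Quot.lift (fun t => bind T (fun j : Num t.1 => unit T (t.2.2 j.down)) (t.2.1 0)) (by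
    rintro _ _ ⟨f, g, v⟩
    -- Composing with `incl f` and then relabelling by `v` is relabelling by `v ∘ f`.
    refine (bind_bind _ _ _).trans ?_
    congr 1
    funext j
    exact bind_unit _ _)

theorem kleisliEval_termMap (T : Monad (Type u)) {X Y : Type u} (f : X → Y)
    (t : (kleisliTheory T).Term X) :
    kleisliEval T Y (LawvereTheory.termMap f t) = T.map (↾f) (kleisliEval T X t) := by
  induction t using LawvereTheory.term_ind with | h g v =>
  refine Eq.trans ?_ (map_bind _ f (g 0)).symm
  refine congrArg (fun k => bind T k (g 0)) (funext fun j => ?_)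
  exact ConcreteCategory.congr_hom (T.η.naturality (↾f)) (v j.down)

/-- Over common variables `w`, both sides bind the operations `p j` along `g` and relabel by `w`,
since composition in the finitary Kleisli category is itself `bind`. -/
theorem kleisliEval_termMul (T : Monad (Type u)) {X : Type u}
    (t : (kleisliTheory T).Term ((kleisliTheory T).Term X)) :
    kleisliEval T X (LawvereTheory.termMul t) =
      bind T (kleisliEval T X) (kleisliEval T ((kleisliTheory T).Term X) t) := by
  induction t using LawvereTheory.term_ind with | h g v =>
  obtain ⟨k, p, w, rfl⟩ := LawvereTheory.exists_common v
  rw [LawvereTheory.termMul_term]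
  refine (bind_bind _ _ _).trans ((bind_bind _ _ _).trans ?_).symm
  congr 1
  funext j
  refine (bind_unit _ _).trans ?_
  change bind T _ (p j.down 0) = bind T _ _
  congr 1
  -- `cotuple` is obtained by choice, so its value at `j` is recovered from its universal property.
  have h := congrFun ((kleisliTheory T).pick_cotuple p j.down) 0
  exact h.symm.trans (bind_unit (T := T) _ _)

/-- The counit of the adjunction `𝒯 ⊣ 𝒦ℓ_ℕ`. -/
def kleisliCounit (T : Monad (Type u)) : (kleisliTheory T).monad ⟶ T where
  app X := ↾kleisliEval T X
  naturality X Y f := by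
    ext t
    exact kleisliEval_termMap T f t
  app_η X := by
    ext x
    exact bind_unit _ _
  app_μ X := by
    ext t
    exact (kleisliEval_termMul T t).trans
      (congrArg (T.μ.app X) (kleisliEval_termMap T (kleisliEval T X) t).symm)

/-- The adjunction `𝒯 ⊣ 𝒦ℓ_ℕ` between Lawvere theories and monads on sets. -/
def theoryAdjunction : theoryMonad.{u} ⊣ kleisliN.{u} :=
  Adjunction.mkOfUnitCounit
    { unit :=
        { app := kleisliUnit
          naturality := fun L K F => by
            refine LawvereMap.ext ?_
            funext n m f i
            change LawvereTheory.term (K.comp (K.pick i) (LawvereMap.map F f)) _ =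
              LawvereTheory.term (LawvereMap.map F (L.comp (L.pick i) f)) _
            rw [LawvereMap.map_comp, LawvereMap.map_pick] }
      counit :=
        { app := kleisliCounit
          naturality := fun T S σ => by
            apply MonadHom.ext'
            funext X
            ext t
            induction t using LawvereTheory.term_ind with | h g v =>
            refine Eq.trans ?_ (map_bind_apply σ _ (g 0)).symm
            refine congrArg (fun k => bind S k (σ.app _ (g 0))) (funext fun j => ?_)
            exact (ConcreteCategory.congr_hom (MonadHom.app_η σ X) (v j.down)).symm }
      left_triangle := by
        ext L : 2
        apply MonadHom.ext'
        funext X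
        ext t
        induction t using LawvereTheory.term_ind with | @h i g v =>
        -- The unit turns `g` into a term in generic variables; evaluation relabels these by `v`,
        -- and `κ_0 : 1 → 1` is the identity.
        refine (LawvereTheory.bind_unit_term (L := L) (fun j : Num i => v j.down)
          (L.comp (L.pick 0) g) ULift.up _root_.id v fun _ => rfl).trans ?_
        rw [L.incl_id, L.comp_id, L.pick_zero_one, L.id_comp]
        rfl
      right_triangle := by
        ext T : 2
        refine LawvereMap.ext ?_
        funext n m f i
        -- The variables are the generic ones, so relabelling is trivial by one unit law; the other
        -- gives the component of `f` at `i`.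
        refine (unit_bind _).trans ?_
        exact bind_unit (T := T) (fun j : Num n => f j.down) (ULift.up i) }

/-! ### Restriction of the adjunction to symmetric monoidal theories and commutative monads. -/

theorem kleisliUnit_tensor (L : SMLawvereTheory.{u}) {n p m q : ℕ} (f : L.Hom n p)
    (g : L.Hom m q) :
    (kleisliUnit L.toLawvereTheory).map (L.tensor f g) =
      kleisliTensor L.monad ((kleisliUnit L.toLawvereTheory).map f)
        ((kleisliUnit L.toLawvereTheory).map g) := by
  funext c
  refine Eq.trans ?_ (kleisliTensor_apply L.monad _ _ c).symm
  -- With `F` the inverse coordinatisation, the grid variables become the generic variables of `p *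
  -- q`, and `pick_tensor` matches the operations.
  refine Eq.trans ?_ (L.bind_bind_term (fun (x : Num p) (y : Num q) =>
    (ULift.up ((co p q).symm (x.down, y.down)) : Num (p * q))) (L.comp (L.pick (co n m c).1) f)
      ULift.up (L.comp (L.pick (co n m c).2) g) ULift.up).symm
  rw [← L.pick_tensor]
  simp only [Prod.mk.eta, Equiv.symm_apply_apply]
  rfl

theorem isCommutative_theoryMonad (L : SMLawvereTheory.{u}) :
    IsCommutative (theoryMonad.obj (forgetSM.obj L)) :=
  L.isCommutative_monad

/-- The adjunction `𝒯 ⊣ 𝒦ℓ_ℕ` between symmetric monoidal Lawvere theories and commutative monads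
on sets. -/
def theoryAdjunctionSM :
    IsCommutative.lift (forgetSM.{u} ⋙ theoryMonad.{u}) isCommutative_theoryMonad ⊣
      kleisliSM.{u} :=
  Adjunction.mkOfUnitCounit
    { unit :=
        { app := fun L => ⟨kleisliUnit L.toLawvereTheory, kleisliUnit_tensor L⟩
          naturality := fun _ _ F => SMLawvereMap.ext
            (congrArg LawvereMap.map (theoryAdjunction.unit.naturality (forgetSM.map F))) }
      counit :=
        -- Fullness: any monad map between commutative monads is a morphism here.
        { app := fun T => ⟨kleisliCounit T.obj⟩
          naturality := fun _ _ σ => ObjectProperty.hom_ext _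
            (theoryAdjunction.counit.naturality σ.hom) }
      left_triangle := by
        ext L : 2
        exact ObjectProperty.hom_ext _
          (theoryAdjunction.left_triangle_components (forgetSM.obj L))
      right_triangle := by
        ext T : 2
        exact SMLawvereMap.ext
          (congrArg LawvereMap.map (theoryAdjunction.right_triangle_components T.obj)) }

end SMLaw

end

/-- The functor `𝒯` from Lawvere theories to monads on sets sends symmetric monoidal Lawvere
theories to commutative monads, and the resulting restriction (all monad maps between commutative
monads are maps of commutative monads) is left adjoint to `𝒦ℓ_ℕ`, by restriction of the adjunction
`𝒯 ⊣ 𝒦ℓ_ℕ` whose unit sends `f : n → m` to `i ↦ [κ_m (f ∘ κ_i, id)]`. -/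
theorem mainTheorem6 :
    ∃ (hT : ∀ L : SMLaw.SMLawvereTheory.{u},
        SMLaw.IsCommutative (SMLaw.theoryMonad.obj (SMLaw.forgetSM.obj L)))
      (adj : SMLaw.theoryMonad.{u} ⊣ SMLaw.kleisliN.{u})
      (adjSM : SMLaw.IsCommutative.lift (SMLaw.forgetSM.{u} ⋙ SMLaw.theoryMonad.{u}) hT ⊣
        SMLaw.kleisliSM.{u}),
      (∀ (L : SMLaw.LawvereTheory.{u}) (n m : ℕ) (f : L.Hom n m) (i : Fin n),
        SMLaw.LawvereMap.map (adj.unit.app L) f i =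
          SMLaw.LawvereTheory.term (X := SMLaw.Num m) (L.comp (L.pick i) f) ULift.up) ∧
      ∀ L : SMLaw.SMLawvereTheory.{u},
        SMLaw.forgetSM.map (adjSM.unit.app L) = adj.unit.app (SMLaw.forgetSM.obj L) :=
  ⟨SMLaw.isCommutative_theoryMonad, SMLaw.theoryAdjunction, SMLaw.theoryAdjunctionSM,
    -- Both adjunctions are built from the explicit unit `kleisliUnit`, so these hold by definition.
    fun _ _ _ _ _ => rfl, fun _ => rfl⟩
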